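/- All rings are commutative with $1\neq 0$ and all subrings are unital. A maximal subring of a ring $R$ is a proper subring of $R$ that is maximal with respect to inclusion among the proper subrings of $R$. A field is called absolutely algebraic if it is algebraic over $\mathbb{F}_p$ for some prime number $p$. Theorem 2.2. Let $E$ be a field. If $E$ is absolutely algebraic, then among the subfields of $E$ that have no maximal subrings there is a largest one (it contains all the others), denoted by $L(E)$. Moreover, for an arbitrary field $E$ the following conditions are equivalent: 1. $E$ has only finitely many maximal subrings. 2. $E$ is absolutely algebraic and $[E:L(E)]$ is finite. 3. $E$ has a subfield $F$ which has no maximal subrings, such that $[E:F]$ is finite. In particular, if one of these conditions holds (so that $L(E)$ is defined), then every subfield $F$ as in (3) is equal to $L(E)$. -/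

import Mathlib

/-- The set of all maximal subrings of a commutative ring: the (unital) subrings that are maximal
with respect to inclusion among the proper subrings. -/
def RgMax (R : Type*) [CommRing R] : Set (Subring R) :=
  {S : Subring R | IsCoatom S}

/-- A commutative ring is submaximal if it possesses a maximal subring. -/
def IsSubmaximal (R : Type*) [CommRing R] : Prop :=
  (RgMax R).Nonempty

/-- A field is absolutely algebraic if it is algebraic over the field with `p` elements for
some prime number `p`. -/
def IsAbsolutelyAlgebraic (E : Type*) [Field E] : Prop :=
  ∃ (p : ℕ) (_ : Fact p.Prime) (_ : Algebra (ZMod p) E), Algebra.IsAlgebraic (ZMod p) E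

/-- The subfields of `E` that have no maximal subrings (as rings in their own right). -/
def nonsubmaximalSubfields (E : Type*) [Field E] : Set (Subfield E) :=
  {K : Subfield E | ¬ IsSubmaximal K}

/-- `L(E)`: the supremum, in the lattice of subfields of `E`, of the subfields that have no
maximal subrings. Whenever a largest such subfield exists, this is it; that it exists for every
absolutely algebraic field is asserted in the theorem. -/
def largestNonsubmaximalSubfield (E : Type*) [Field E] : Subfield E :=
  sSup (nonsubmaximalSubfields E)

/-!
A field `E` that is not absolutely algebraic has infinitely many maximal subrings: it is algebraic
over a polynomial ring `D` (over `ℤ` or `𝔽_p`, in the elements of a transcendence basis), and each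
prime element `q` of `D` gives a maximal subring of `E` above a valuation ring dominating `D` at
`(q)`; a variant of Euclid's proof shows that infinitely many arise
(`infinite_RgMax_of_not_isAbsolutelyAlgebraic`). In particular, a field without maximal subrings is
absolutely algebraic.

If `E` is absolutely algebraic, its subrings are fields, and `E` is finite Galois over each maximal
subring `M`. A subfield `F` not contained in `M` carries a nontrivial action of the finite group
`Gal(E/M)`, so it is a nontrivial finite extension of its fixed field and has a maximal subring.
Thus the subfields without maximal subrings lie in every maximal subring
(`IsAbsolutelyAlgebraic.algebraMap_mem_of_isCoatom`). This makes their supremum `L(E)` one of them;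
and it shows that if `E` is finite over such a subfield `F`, the maximal subrings of `E` are among
the finitely many intermediate fields of `E / F`.

Conversely, suppose that `E` has finitely many maximal subrings, and choose a finite subfield
`𝔽_p(α)` contained in none of them. The indices `[E : F]` of the subfields with `F(α) = E` are
bounded, and a subfield attaining the largest one has no maximal subring, for a maximal subring `M`
of it would give a maximal subring of `E` containing `M(α)`
(`exists_not_isSubmaximal_finiteDimensional`).
-/

/-! ### Existence of maximal subrings -/

/-- A proper subring `S` of a ring that is generated over `S` by a finite set lies in a maximal
subring: by finiteness of `T`, the union of a chain of proper subrings over `S` is proper. -/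
theorem exists_isCoatom_of_forall_eq_top {R : Type*} [CommRing R] {S : Subring R} {T : Set R}
    (hT : T.Finite) (hS : S ≠ ⊤) (h : ∀ W : Subring R, S ≤ W → T ⊆ W → W = ⊤) :
    ∃ V : Subring R, S ≤ V ∧ IsCoatom V := by
  obtain ⟨V, hSV, hV⟩ := zorn_le_nonempty₀ {W : Subring R | S ≤ W ∧ W ≠ ⊤}
      (fun c hc hchain y hy ↦ by
    have : Nonempty c := ⟨⟨y, hy⟩⟩
    have hdir : Directed (· ≤ ·) (fun i : c ↦ i.1) := hchain.directed
    refine ⟨⨆ i : c, i.1, ⟨(hc hy).1.trans (le_iSup (fun i : c ↦ i.1) ⟨y, hy⟩), fun htop ↦ ?_⟩,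
      fun z hz ↦ le_iSup (fun i : c ↦ i.1) ⟨z, hz⟩⟩
    have key : ∃ i : c, T ⊆ i.1 := by
      refine hT.induction_on_subset (motive := fun U _ ↦ ∃ i : c, U ⊆ (i.1 : Set R)) T
        ⟨⟨y, hy⟩, Set.empty_subset _⟩ ?_
      rintro a U - - - ⟨i, hi⟩
      obtain ⟨j, hj⟩ := (Subring.mem_iSup_of_directed hdir).mp (htop ▸ Subring.mem_top a)
      obtain ⟨l, hil, hjl⟩ := hdir i j
      exact ⟨l, Set.insert_subset (hjl hj) (hi.trans hil)⟩
    obtain ⟨i, hi⟩ := key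
    exact (hc i.2).2 (h _ (hc i.2).1 hi)) S ⟨le_rfl, hS⟩
  refine ⟨V, hSV, hV.prop.2, fun W hVW ↦ ?_⟩
  by_contra hW
  exact hVW.not_ge (hV.le_of_ge ⟨hSV.trans hVW.le, hW⟩ hVW.le)

/-! ### Fields that are not absolutely algebraic -/

section Valuation

variable {D E : Type*} [CommRing D] [Field E] [Algebra D E] [FaithfulSMul D E]

/-- Some valuation ring of `E` dominates the localization of `D` at the prime ideal `(q)`. -/
theorem exists_valuationSubring_of_prime {q : D} (hq : Prime q) :
    ∃ V : ValuationSubring E, (∀ d, algebraMap D E d ∈ V) ∧ (algebraMap D E q)⁻¹ ∉ V ∧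
      ∀ d, ¬ q ∣ d → (algebraMap D E d)⁻¹ ∈ V := by
  have hinj := FaithfulSMul.algebraMap_injective D E
  have hP : (Ideal.span {q}).IsPrime := (Ideal.span_singleton_prime hq.ne_zero).mpr hq
  let f : Localization.AtPrime (Ideal.span {q}) →+* E :=
    IsLocalization.lift (M := (Ideal.span {q}).primeCompl) (g := algebraMap D E) (fun y ↦ by
      rw [isUnit_iff_ne_zero, Ne, map_eq_zero_iff _ hinj]
      rintro h
      exact y.2 (h ▸ Ideal.zero_mem _))
  have hf (d : D) : f (algebraMap D _ d) = algebraMap D E d := IsLocalization.lift_eq _ _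
  obtain ⟨V, h, hloc⟩ := IsLocalRing.exists_factor_valuationRing f
  refine ⟨V, fun d ↦ hf d ▸ h _, fun hV ↦ ?_, fun d hd ↦ ?_⟩
  · have hu : IsUnit (f.codRestrict V.toSubring h (algebraMap D _ q)) := by
      refine isUnit_iff_exists_inv.mpr ⟨⟨_, hV⟩, Subtype.ext ?_⟩
      change f (algebraMap D _ q) * (algebraMap D E q)⁻¹ = 1
      rw [hf, mul_inv_cancel₀]
      rw [Ne, map_eq_zero_iff _ hinj]
      exact hq.ne_zero
    have := hloc.map_nonunit _ hu
    rw [IsLocalization.AtPrime.isUnit_to_map_iff _ (Ideal.span {q})] at this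
    exact this (Ideal.mem_span_singleton_self q)
  · have hu : IsUnit (algebraMap D (Localization.AtPrime (Ideal.span {q})) d) := by
      rw [IsLocalization.AtPrime.isUnit_to_map_iff _ (Ideal.span {q})]
      simpa [Ideal.primeCompl, Ideal.mem_span_singleton] using hd
    obtain ⟨b, hb⟩ := isUnit_iff_exists_inv.mp hu
    have : algebraMap D E d * f b = 1 := by rw [← hf, ← map_mul, hb, map_one]
    rw [inv_eq_of_mul_eq_one_right this]
    exact h b

variable [IsDomain D] [Algebra.IsAlgebraic D E]

/-- The maximal subring is found above a valuation ring `V` dominating `D` localized at `(q)`.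
Every element of `E` is a fraction with numerator in `V` and denominator in `D`, and by unique
factorization such a denominator is a power of `q` times a unit of `V`; so `q⁻¹` generates `E`
over `V`. -/
theorem exists_isCoatom_of_prime [UniqueFactorizationMonoid D] {q : D} (hq : Prime q) :
    ∃ W : Subring E, IsCoatom W ∧ (∀ x, x ∈ W ∨ x⁻¹ ∈ W) ∧ (∀ d, algebraMap D E d ∈ W) ∧
      (algebraMap D E q)⁻¹ ∉ W := by
  have hinj := FaithfulSMul.algebraMap_injective D E
  obtain ⟨V, hD, hqV, hunit⟩ := exists_valuationSubring_of_prime (E := E) hq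
  have hq0 : algebraMap D E q ≠ 0 := by
    rw [Ne, map_eq_zero_iff _ hinj]
    exact hq.ne_zero
  have hgen : ∀ W : Subring E, V.toSubring ≤ W → (algebraMap D E q)⁻¹ ∈ W → W = ⊤ := by
    intro W hVW hqW
    refine (Subring.eq_top_iff' W).mpr fun w ↦ ?_
    by_cases hwV : w ∈ V
    · exact hVW hwV
    have hyV : w⁻¹ ∈ V := (V.mem_or_inv_mem w).resolve_left hwV
    have hw0 : w ≠ 0 := by
      rintro rfl
      exact hwV V.zero_mem
    obtain ⟨P, hP0, hP⟩ := (Algebra.IsAlgebraic.isAlgebraic (R := D)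
      w⁻¹).exists_nonzero_coeff_and_aeval_eq_zero (mem_nonZeroDivisors_of_ne_zero (inv_ne_zero hw0))
    -- `P(w⁻¹) = 0` exhibits `w` as an element of `V` divided by the constant coefficient of `P`.
    have hg : Polynomial.aeval w⁻¹ P.divX ∈ V := by
      rw [Polynomial.aeval_eq_sum_range]
      refine sum_mem fun i _ ↦ ?_
      rw [Algebra.smul_def]
      exact V.mul_mem _ _ (hD _) (pow_mem hyV _)
    have hw : w = -Polynomial.aeval w⁻¹ P.divX * (algebraMap D E (P.coeff 0))⁻¹ := by
      rw [← P.divX_mul_X_add] at hP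
      simp only [map_add, map_mul, Polynomial.aeval_X, Polynomial.aeval_C] at hP
      have ha : algebraMap D E (P.coeff 0) ≠ 0 := by
        rwa [Ne, map_eq_zero_iff _ hinj]
      field_simp at hP ⊢
      linear_combination hP
    have ha : (algebraMap D E (P.coeff 0))⁻¹ ∈ W := by
      obtain ⟨u, heq, hu⟩ :=
        (FiniteMultiplicity.of_prime_left hq hP0).exists_eq_pow_mul_and_not_dvd
      rw [heq, map_mul, map_pow, mul_inv, ← inv_pow]
      exact W.mul_mem (pow_mem hqW _) (hVW (hunit _ hu))
    rw [hw]
    exact W.mul_mem (W.neg_mem (hVW hg)) ha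
  obtain ⟨W, hVW, hW⟩ := exists_isCoatom_of_forall_eq_top (S := V.toSubring)
    (Set.finite_singleton (algebraMap D E q)⁻¹) (fun h ↦ hqV ((Subring.eq_top_iff' _).mp h _))
    (fun W hW hT ↦ hgen W hW (hT rfl))
  exact ⟨W, hW, fun x ↦ (V.mem_or_inv_mem x).imp (@hVW _) (@hVW _), fun d ↦ hVW (hD d),
    fun h ↦ hW.1 (hgen W hVW h)⟩

/-- Euclid's argument. Assume that there are finitely many maximal subrings, and let `b` be a
suitable multiple of a product of nonzero elements of `D`, one for each of them and a nonunit in it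
where `D` has such an element. A prime factor of
`b + 1` then yields a maximal subring in which both `b` and `b + 1` are nonunits, although it is a
valuation ring. The condition on `D` says that `0` is the only element of its Jacobson radical, and
that `D` is not a field. -/
theorem infinite_RgMax_of_forall_exists_not_isUnit [UniqueFactorizationMonoid D]
    (hD : ∀ d : D, d ≠ 0 → ∃ c : D, c * d + 1 ≠ 0 ∧ ¬ IsUnit (c * d + 1)) :
    (RgMax E).Infinite := by
  classical
  intro hfin
  have hinj := FaithfulSMul.algebraMap_injective D E
  -- A nonzero `δ W ∈ D` whose inverse avoids `W`, whenever there is one.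
  have hδ : ∀ W : Subring E, ∃ d : D, d ≠ 0 ∧
      ((∃ d' : D, d' ≠ 0 ∧ (algebraMap D E d')⁻¹ ∉ W) → (algebraMap D E d)⁻¹ ∉ W) := by
    intro W
    by_cases h : ∃ d' : D, d' ≠ 0 ∧ (algebraMap D E d')⁻¹ ∉ W
    · obtain ⟨d, hd0, hd⟩ := h
      exact ⟨d, hd0, fun _ ↦ hd⟩
    · exact ⟨1, one_ne_zero, fun h' ↦ (h h').elim⟩
  choose δ hδ0 hδ using hδ
  obtain ⟨c, hc0, hcu⟩ := hD (∏ W ∈ hfin.toFinset, δ W)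
    (Finset.prod_ne_zero_iff.mpr fun W _ ↦ hδ0 W)
  obtain ⟨q, hq, s, hs⟩ := WfDvdMonoid.exists_irreducible_factor hcu hc0
  obtain ⟨W, hW, hval, hDW, hqW⟩ := exists_isCoatom_of_prime (E := E) hq.prime
  have hdvd : δ W ∣ c * ∏ W ∈ hfin.toFinset, δ W :=
    (Finset.dvd_prod_of_mem δ (hfin.mem_toFinset.mpr hW)).mul_left c
  set b := c * ∏ W ∈ hfin.toFinset, δ W with hb
  obtain ⟨r, hr⟩ := hdvd
  have hb0 : b ≠ 0 := by
    rintro h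
    rw [h, zero_add] at hcu
    exact hcu isUnit_one
  have hcancel : ∀ {x y z : D}, x = y * z → x ≠ 0 → (algebraMap D E y)⁻¹ ∉ W →
      (algebraMap D E x)⁻¹ ∉ W := by
    intro x y z hxy hx hy hxW
    refine hy ?_
    have hx' : algebraMap D E x ≠ 0 := by rwa [Ne, map_eq_zero_iff _ hinj]
    have hyz : algebraMap D E x = algebraMap D E y * algebraMap D E z := by rw [hxy, map_mul]
    have : (algebraMap D E y)⁻¹ = (algebraMap D E x)⁻¹ * algebraMap D E z := by
      rw [hyz] at hx' ⊢
      have h1 := left_ne_zero_of_mul hx'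
      have h2 := right_ne_zero_of_mul hx'
      field_simp
    rw [this]
    exact W.mul_mem hxW (hDW z)
  have h1 : (algebraMap D E (b + 1))⁻¹ ∉ W := hcancel hs hc0 hqW
  have h2 : (algebraMap D E b)⁻¹ ∉ W := hcancel hr hb0 (hδ W ⟨q, hq.ne_zero, hqW⟩)
  have hx : algebraMap D E (b + 1) ≠ 0 := by rwa [Ne, map_eq_zero_iff _ hinj]
  have hy : algebraMap D E b ≠ 0 := by rwa [Ne, map_eq_zero_iff _ hinj]
  have hxy : algebraMap D E (b + 1) = algebraMap D E b + 1 := by rw [map_add, map_one]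
  set x := algebraMap D E (b + 1)
  set y := algebraMap D E b
  -- `b` and `b + 1` are both nonunits of the valuation ring `W`, although they differ by `1`.
  rcases hval (x * y⁻¹) with h | h
  · refine h2 ?_
    have : y⁻¹ = x * y⁻¹ - 1 := by
      rw [hxy]
      field_simp
      ring
    rw [this]
    exact W.sub_mem h W.one_mem
  · refine h1 ?_
    have : x⁻¹ = 1 - (x * y⁻¹)⁻¹ := by
      have : y = x - 1 := by rw [hxy]; ring
      field_simp
      rw [this]
      ring
    rw [this]
    exact W.sub_mem W.one_mem h

end Valuation

theorem infinite_RgMax_of_isTranscendenceBasis {k E ι : Type*} [CommRing k] [IsDomain k]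
    [UniqueFactorizationMonoid k] [Field E] [Algebra k E] {x : ι → E}
    (hx : IsTranscendenceBasis k x)
    (hk : ∀ d : MvPolynomial ι k, d ≠ 0 → ∃ c, c * d + 1 ≠ 0 ∧ ¬ IsUnit (c * d + 1)) :
    (RgMax E).Infinite := by
  let e := hx.1.aevalEquiv
  have := hx.isAlgebraic
  have : UniqueFactorizationMonoid (Algebra.adjoin k (Set.range x)) :=
    e.toMulEquiv.uniqueFactorizationMonoid inferInstance
  refine infinite_RgMax_of_forall_exists_not_isUnit (D := Algebra.adjoin k (Set.range x))
    fun d hd ↦ ?_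
  obtain ⟨c, hc0, hcu⟩ := hk (e.symm d) (by simpa using hd)
  have hc : e c * d + 1 = e (c * e.symm d + 1) := by simp
  refine ⟨e c, ?_, ?_⟩
  · rwa [hc, Ne, map_eq_zero_iff e e.injective]
  · rwa [hc, MulEquiv.isUnit_map]

/-- In characteristic `0` the transcendence basis is taken over `ℤ`, so that it may be empty, and
nonunits `3 * d + 1` are available even then; in characteristic `p` it is taken over `ZMod p`, is
nonempty, and the nonunits are `X i * d + 1`. -/
theorem infinite_RgMax_of_not_isAbsolutelyAlgebraic {E : Type*} [Field E]
    (hE : ¬ IsAbsolutelyAlgebraic E) : (RgMax E).Infinite := by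
  obtain ⟨p, hp⟩ := CharP.exists E
  rcases CharP.char_is_prime_or_zero E p with hprime | rfl
  · have : Fact p.Prime := ⟨hprime⟩
    let : Algebra (ZMod p) E := ZMod.algebra E p
    obtain ⟨ι, x, hx⟩ := exists_isTranscendenceBasis' (ZMod p) E
    have hι : Nonempty ι := by
      rw [← not_isEmpty_iff, hx.isEmpty_iff_isAlgebraic]
      exact fun h ↦ hE ⟨p, ‹_›, ‹_›, h⟩
    obtain ⟨i⟩ := hι
    refine infinite_RgMax_of_isTranscendenceBasis hx fun d hd ↦ ⟨MvPolynomial.X i, ?_, ?_⟩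
    · intro h
      simpa using congr(MvPolynomial.constantCoeff $h)
    · intro h
      obtain ⟨r, -, hr⟩ := MvPolynomial.isUnit_iff_eq_C_of_isReduced.mp h
      have h1 : r = 1 := by simpa using congr(MvPolynomial.constantCoeff $hr).symm
      rw [h1, map_one, add_eq_right] at hr
      exact mul_ne_zero (MvPolynomial.X_ne_zero i) hd hr
  · have : CharZero E := CharP.charP_to_charZero E
    have : FaithfulSMul ℤ E := inferInstance
    obtain ⟨ι, x, hx⟩ := exists_isTranscendenceBasis' ℤ E
    -- The only unit of `ℤ` congruent to `1` modulo `3` is `1`.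
    refine infinite_RgMax_of_isTranscendenceBasis hx fun d hd ↦ ⟨MvPolynomial.C 3, ?_, ?_⟩
    · intro h
      have := congr(MvPolynomial.constantCoeff $h)
      simp only [map_add, map_mul, MvPolynomial.constantCoeff_C, map_one, map_zero] at this
      omega
    · intro h
      obtain ⟨r, hr, hr'⟩ := MvPolynomial.isUnit_iff_eq_C_of_isReduced.mp h
      have h1 : 3 * MvPolynomial.constantCoeff d + 1 = r := by
        simpa only [map_add, map_mul, MvPolynomial.constantCoeff_C, map_one] using
          congr(MvPolynomial.constantCoeff $hr')
      have h2 : r = 1 := by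
        rcases Int.isUnit_iff.mp hr with h | h <;> omega
      rw [h2, map_one, add_eq_right] at hr'
      exact mul_ne_zero (by simp) hd hr'

/-! ### Fields without maximal subrings lie in every maximal subring -/

theorem IsSubmaximal.of_finiteDimensional {K F : Type*} [Field K] [Field F] [Algebra K F]
    [FiniteDimensional K F] (h : ¬ Function.Surjective (algebraMap K F)) : IsSubmaximal F := by
  obtain ⟨T, hT⟩ := Module.Finite.fg_top (R := K) (M := F)
  obtain ⟨V, -, hV⟩ := exists_isCoatom_of_forall_eq_top (S := (algebraMap K F).range)
    T.finite_toSet (fun htop ↦ h (RingHom.range_eq_top.mp htop)) (fun W hW hTW ↦ by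
      refine (Subring.eq_top_iff' W).mpr fun x ↦ ?_
      have hx : x ∈ Submodule.span K (T : Set F) := hT ▸ Submodule.mem_top
      induction hx using Submodule.span_induction with
      | mem y hy => exact hTW hy
      | zero => exact W.zero_mem
      | add y z _ _ hy hz => exact W.add_mem hy hz
      | smul a y _ hy =>
        rw [Algebra.smul_def]
        exact W.mul_mem (hW ⟨a, rfl⟩) hy)
  exact ⟨V, hV⟩

/-- The finite group `Gal(E/K)` acts on `F` because `F / k` is normal. By Artin's theorem `F` is
finite over the fixed field of this action, which does not contain `x`; hence `F` is a nontrivial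
finite extension of some subfield. -/
theorem IsSubmaximal.of_notMem {k F E : Type*} [Field k] [Field F] [Field E] [Algebra k F]
    [Algebra k E] [Algebra F E] [IsScalarTower k F E] [IsGalois k E] [Normal k F]
    (K : IntermediateField k E) [FiniteDimensional K E] {x : F} (hx : algebraMap F E x ∉ K) :
    IsSubmaximal F := by
  let ρ : Gal(E/K) →* Gal(F/k) := (AlgEquiv.restrictNormalHom F).comp
    (AlgEquiv.restrictScalarsHom k)
  have : Finite ρ.range := Set.finite_range ρ
  refine IsSubmaximal.of_finiteDimensional (K := FixedPoints.subfield ρ.range F) fun hsurj ↦ hx ?_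
  have hfix : ∀ σ : Gal(E/K), σ (algebraMap F E x) = algebraMap F E x := by
    intro σ
    obtain ⟨y, rfl⟩ := hsurj x
    have h1 : ρ σ (y : F) = y := y.2 ⟨ρ σ, σ, rfl⟩
    have h2 := AlgEquiv.restrictNormal_commutes (σ.restrictScalars k) F (y : F)
    change algebraMap F E (ρ σ y) = σ (algebraMap F E y) at h2
    rw [h1] at h2
    exact h2.symm
  obtain ⟨z, hz⟩ := (IsGalois.mem_range_algebraMap_iff_fixed (F := K) (algebraMap F E x)).mpr hfix
  rw [← hz]
  exact z.2

/-- A subring of an algebraic field extension `E / k` that contains `k`, regarded as an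
intermediate field: it is closed under inverses because its elements are algebraic over `k`. -/
def Subring.toIntermediateField {k E : Type*} [Field k] [Field E] [Algebra k E]
    [Algebra.IsAlgebraic k E] (S : Subring E) (hS : ∀ a : k, algebraMap k E a ∈ S) :
    IntermediateField k E :=
  let A : Subalgebra k E := { S with algebraMap_mem' := hS }
  A.toIntermediateField fun x hx ↦
    A.inv_mem_of_algebraic (x := ⟨x, hx⟩) (Algebra.IsAlgebraic.isAlgebraic x)

section FiniteField

variable {k E : Type*} [Field k] [Finite k] [Field E] [Algebra k E] [Algebra.IsAlgebraic k E]

theorem normal_of_isAlgebraic_of_finite : Normal k E where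
  splits' x := by
    have hx : IsIntegral k x := Algebra.IsIntegral.isIntegral x
    have : FiniteDimensional k (IntermediateField.adjoin k {x}) :=
      IntermediateField.adjoin.finiteDimensional hx
    have : Finite (IntermediateField.adjoin k {x}) := Module.finite_of_finite k
    have := (inferInstance : Normal k (IntermediateField.adjoin k {x})).splits
      (IntermediateField.AdjoinSimple.gen k x)
    rw [IntermediateField.minpoly_gen] at this
    have := this.map (algebraMap (IntermediateField.adjoin k {x}) E)
    rwa [Polynomial.map_map, ← IsScalarTower.algebraMap_eq] at this

theorem isGalois_of_isAlgebraic_of_finite : IsGalois k E where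
  to_normal := normal_of_isAlgebraic_of_finite

end FiniteField

section PrimeField

variable {p : ℕ} [Fact p.Prime] {E : Type*} [Field E] [Algebra (ZMod p) E]

theorem algebraMap_zmod_mem (S : Subring E) (a : ZMod p) : algebraMap (ZMod p) E a ∈ S := by
  rw [← ZMod.natCast_zmod_val a, map_natCast]
  exact natCast_mem S _

variable [Algebra.IsAlgebraic (ZMod p) E]

/-- A maximal subring `M` is a field, and adjoining to it any one element outside `M` gives the
whole of `E`. -/
theorem finiteDimensional_of_isCoatom {M : Subring E} (hM : IsCoatom M) :
    FiniteDimensional (M.toIntermediateField (algebraMap_zmod_mem (p := p) M)) E := by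
  set K := M.toIntermediateField (algebraMap_zmod_mem (p := p) M) with hK
  obtain ⟨x, hx⟩ : ∃ x, x ∉ M := by
    by_contra! h
    exact hM.1 ((Subring.eq_top_iff' M).mpr h)
  have htop : IntermediateField.adjoin K {x} = ⊤ := by
    have : (IntermediateField.adjoin K {x}).toSubfield.toSubring = ⊤ := by
      refine hM.2 _ (SetLike.lt_iff_le_and_exists.mpr ⟨fun y hy ↦ ?_, x, ?_, hx⟩)
      · exact (IntermediateField.adjoin K {x}).algebraMap_mem ⟨y, hy⟩
      · exact IntermediateField.mem_adjoin_simple_self K x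
    exact eq_top_iff.mpr fun y _ ↦ (this ▸ Subring.mem_top y :
      y ∈ (IntermediateField.adjoin K {x}).toSubfield.toSubring)
  have hint : IsIntegral K x := (Algebra.IsIntegral.isIntegral (R := ZMod p) x).tower_top
  have := IntermediateField.adjoin.finiteDimensional hint
  rw [htop] at this
  exact IntermediateField.topEquiv.toLinearEquiv.finiteDimensional

variable (p) in
theorem mem_of_isCoatom_of_not_isSubmaximal {F : Type*} [Field F] [Algebra (ZMod p) F]
    [Algebra F E] [IsScalarTower (ZMod p) F E] (hF : ¬ IsSubmaximal F) {M : Subring E}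
    (hM : IsCoatom M) (x : F) : algebraMap F E x ∈ M := by
  by_contra hx
  have := finiteDimensional_of_isCoatom (p := p) hM
  have : IsGalois (ZMod p) E := isGalois_of_isAlgebraic_of_finite
  have : Algebra.IsAlgebraic (ZMod p) F := Algebra.IsAlgebraic.tower_bot (ZMod p) F E
  have : Normal (ZMod p) F := normal_of_isAlgebraic_of_finite
  exact hF (IsSubmaximal.of_notMem (M.toIntermediateField (algebraMap_zmod_mem (p := p) M)) hx)

end PrimeField

theorem IsAbsolutelyAlgebraic.exists_isScalarTower {F E : Type*} [Field F] [Field E] [Algebra F E]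
    (hE : IsAbsolutelyAlgebraic E) :
    ∃ (p : ℕ) (_ : Fact p.Prime) (_ : Algebra (ZMod p) F) (_ : Algebra (ZMod p) E),
      IsScalarTower (ZMod p) F E ∧ Algebra.IsAlgebraic (ZMod p) F ∧
        Algebra.IsAlgebraic (ZMod p) E := by
  obtain ⟨p, hp, _, halg⟩ := hE
  have : CharP E p := charP_of_injective_algebraMap' (ZMod p) p
  have : CharP F p := (algebraMap F E).charP (algebraMap F E).injective p
  let : Algebra (ZMod p) F := ZMod.algebra F p
  have : IsScalarTower (ZMod p) F E := IsScalarTower.of_algebraMap_eq' (RingHom.ext_zmod _ _)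
  exact ⟨p, hp, _, _, this, Algebra.IsAlgebraic.tower_bot (ZMod p) F E, halg⟩

theorem IsAbsolutelyAlgebraic.of_isAlgebraic {F E : Type*} [Field F] [Field E] [Algebra F E]
    [Algebra.IsAlgebraic F E] (hF : IsAbsolutelyAlgebraic F) : IsAbsolutelyAlgebraic E := by
  obtain ⟨p, hp, _, halg⟩ := hF
  let : Algebra (ZMod p) E := ((algebraMap F E).comp (algebraMap (ZMod p) F)).toAlgebra
  have : IsScalarTower (ZMod p) F E := IsScalarTower.of_algebraMap_eq' rfl
  exact ⟨p, hp, _, Algebra.IsAlgebraic.trans (ZMod p) F E⟩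

theorem isAbsolutelyAlgebraic_of_not_isSubmaximal {F : Type*} [Field F] (hF : ¬ IsSubmaximal F) :
    IsAbsolutelyAlgebraic F := by
  by_contra h
  exact hF (infinite_RgMax_of_not_isAbsolutelyAlgebraic h).nonempty

/-- A field `F` without maximal subrings embedded in an absolutely algebraic field `E` lands in
every maximal subring of `E`. -/
theorem IsAbsolutelyAlgebraic.algebraMap_mem_of_isCoatom {F E : Type*} [Field F] [Field E]
    [Algebra F E] (hE : IsAbsolutelyAlgebraic E) (hF : ¬ IsSubmaximal F) {M : Subring E}
    (hM : IsCoatom M) (x : F) : algebraMap F E x ∈ M := by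
  obtain ⟨p, _, _, _, _, _, _⟩ := hE.exists_isScalarTower (F := F)
  exact mem_of_isCoatom_of_not_isSubmaximal p hF hM x

/-- All maximal subrings of `E` contain `F`, so they are intermediate fields of the finite separable
extension `E / F`, of which there are finitely many. -/
theorem finite_RgMax_of_finiteDimensional {F E : Type*} [Field F] [Field E] [Algebra F E]
    [FiniteDimensional F E] (hF : ¬ IsSubmaximal F) : (RgMax E).Finite := by
  have hE : IsAbsolutelyAlgebraic E :=
    (isAbsolutelyAlgebraic_of_not_isSubmaximal hF).of_isAlgebraic
  have : PerfectField F := by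
    obtain ⟨p, _, _, _⟩ := isAbsolutelyAlgebraic_of_not_isSubmaximal hF
    exact Algebra.IsAlgebraic.perfectField (ZMod p)
  have : Finite (IntermediateField F E) :=
    Field.finite_intermediateField_of_exists_primitive_element F E
      (Field.exists_primitive_element F E)
  refine (Set.finite_range fun K : IntermediateField F E ↦ K.toSubfield.toSubring).subset ?_
  intro M hM
  exact ⟨M.toIntermediateField (hE.algebraMap_mem_of_isCoatom hF hM), rfl⟩

/-! ### The largest subfield without maximal subrings -/

section Subfield

variable {E : Type*} [Field E]

theorem IsAbsolutelyAlgebraic.subfield (hE : IsAbsolutelyAlgebraic E) (L : Subfield E) :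
    IsAbsolutelyAlgebraic L := by
  obtain ⟨p, _, _, _, _, _, _⟩ := hE.exists_isScalarTower (F := L)
  exact ⟨p, ‹_›, ‹_›, ‹_›⟩

/-- A maximal subring of the supremum would contain each subfield without maximal subrings, hence
the supremum itself. -/
theorem isGreatest_largestNonsubmaximalSubfield (hE : IsAbsolutelyAlgebraic E) :
    IsGreatest (nonsubmaximalSubfields E) (largestNonsubmaximalSubfield E) := by
  refine ⟨?_, fun F hF ↦ le_sSup hF⟩
  set L := largestNonsubmaximalSubfield E
  rintro ⟨M, hM⟩
  have hL := hE.subfield L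
  obtain ⟨p, _, _, _⟩ := hE.subfield L
  let M' : Subfield E :=
    (M.toIntermediateField (algebraMap_zmod_mem (p := p) M)).toSubfield.map L.subtype
  have hLM : L ≤ M' := sSup_le fun F hF y hy ↦ by
    have hFL : F ≤ L := le_sSup hF
    let : Algebra F L := (Subfield.inclusion hFL).toAlgebra
    exact ⟨Subfield.inclusion hFL ⟨y, hy⟩, hL.algebraMap_mem_of_isCoatom hF hM ⟨y, hy⟩, rfl⟩
  refine hM.1 ((Subring.eq_top_iff' M).mpr fun x ↦ ?_)
  obtain ⟨y, hy, hyx⟩ := hLM x.2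
  exact Subtype.ext hyx ▸ hy

/-- The largest subfield without maximal subrings is finite over `F`; were the inclusion strict, it
would have a maximal subring. -/
theorem eq_largestNonsubmaximalSubfield {F : Subfield E} [FiniteDimensional F E]
    (hF : ¬ IsSubmaximal F) : F = largestNonsubmaximalSubfield E := by
  have hE : IsAbsolutelyAlgebraic E :=
    (isAbsolutelyAlgebraic_of_not_isSubmaximal hF).of_isAlgebraic
  obtain ⟨hL, hmax⟩ := isGreatest_largestNonsubmaximalSubfield hE
  refine (hmax hF).antisymm fun x hx ↦ ?_
  let K := Subfield.extendScalars (hmax hF)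
  by_contra hxF
  refine hL (IsSubmaximal.of_finiteDimensional (K := F) (F := K) fun hsurj ↦ hxF ?_)
  obtain ⟨y, hy⟩ := hsurj ⟨x, hx⟩
  have : (y : E) = x := congr(($hy : E))
  exact this ▸ y.2

end Subfield

/-! ### Subfields of finite index without maximal subrings -/

section FiniteIndex

variable {k E : Type*} [Field k] [Field E] [Algebra k E] [Algebra.IsAlgebraic k E]

theorem finrank_le_of_sup_adjoin_eq_top {α : E} {F : IntermediateField k E}
    (h : F ⊔ IntermediateField.adjoin k {α} = ⊤) :
    FiniteDimensional F E ∧ Module.finrank F E ≤ (minpoly k α).natDegree := by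
  have hk : IsIntegral k α := Algebra.IsIntegral.isIntegral α
  have hint : IsIntegral F α := hk.tower_top
  have htop : IntermediateField.adjoin F {α} = ⊤ := by
    refine (IntermediateField.restrictScalars_eq_top_iff (K := k)).mp (top_unique ?_)
    rw [← h]
    refine sup_le (fun x hx ↦ (IntermediateField.adjoin F {α}).algebraMap_mem ⟨x, hx⟩) ?_
    rw [IntermediateField.adjoin_simple_le_iff]
    exact IntermediateField.mem_adjoin_simple_self F α
  have hfd := IntermediateField.adjoin.finiteDimensional hint
  have hfr := IntermediateField.adjoin.finrank hint
  rw [htop] at hfd hfr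
  refine ⟨IntermediateField.topEquiv.toLinearEquiv.finiteDimensional, ?_⟩
  rw [IntermediateField.finrank_top'] at hfr
  rw [hfr, ← Polynomial.natDegree_map_eq_of_injective (algebraMap k F).injective (minpoly k α)]
  exact Polynomial.natDegree_le_of_dvd (minpoly.dvd_map_of_isScalarTower k F α)
    (Polynomial.map_ne_zero (minpoly.ne_zero hk))

/-- Among the subfields `F` with `F(α) = E` the index `[E : F]` is bounded by the degree of `α`
over `k`; one of largest index is minimal. -/
theorem exists_sup_adjoin_eq_top_minimal (α : E) :
    ∃ F : IntermediateField k E, F ⊔ IntermediateField.adjoin k {α} = ⊤ ∧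
      FiniteDimensional F E ∧
      ∀ M < F, M ⊔ IntermediateField.adjoin k {α} ≠ ⊤ := by
  obtain ⟨F, hF, hmin⟩ := WellFounded.has_min
    (measure fun F : IntermediateField k E ↦ (minpoly k α).natDegree - Module.finrank F E).wf
    {F | F ⊔ IntermediateField.adjoin k {α} = ⊤} ⟨⊤, top_sup_eq _⟩
  refine ⟨F, hF, (finrank_le_of_sup_adjoin_eq_top hF).1, fun M hMF hM ↦ hmin M hM ?_⟩
  obtain ⟨hfd, hle⟩ := finrank_le_of_sup_adjoin_eq_top hM
  have := IntermediateField.finrank_lt_of_gt hMF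
  change (minpoly k α).natDegree - Module.finrank M E <
    (minpoly k α).natDegree - Module.finrank F E
  omega

/-- Choose an element outside each of the finitely many maximal subrings of `E`, let `α` generate
the field that these elements generate over `k`, and let `F` be minimal with `F(α) = E`. If `F` had
a maximal subring `M`, then `M(α)` would be a proper subfield over which `E` is finitely generated,
hence contained in a maximal subring of `E`. But no maximal subring of `E` contains `α`.
The hypothesis `hk` says that `k` is the prime field. -/
theorem exists_not_isSubmaximal_finiteDimensional [Finite k]
    (hk : ∀ (S : Subring E) (a : k), algebraMap k E a ∈ S) (hfin : (RgMax E).Finite) :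
    ∃ F : IntermediateField k E, ¬ IsSubmaximal F ∧ FiniteDimensional F E := by
  have hex : ∀ V : Subring E, ∃ x, V ∈ RgMax E → x ∉ V := by
    intro V
    by_contra! h
    exact (h 0).1.1 ((Subring.eq_top_iff' V).mpr fun x ↦ (h x).2)
  choose a ha using hex
  have : Finite (a '' RgMax E) := hfin.image a
  have : FiniteDimensional k (IntermediateField.adjoin k (a '' RgMax E)) :=
    IntermediateField.finiteDimensional_adjoin fun x _ ↦ Algebra.IsIntegral.isIntegral x
  obtain ⟨α, hα⟩ : ∃ α : E, IntermediateField.adjoin k (a '' RgMax E) =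
      IntermediateField.adjoin k {α} := by
    obtain ⟨α, hα⟩ := Field.exists_primitive_element k (IntermediateField.adjoin k (a '' RgMax E))
    refine ⟨α, ?_⟩
    rw [← IntermediateField.lift_adjoin_simple, hα, IntermediateField.lift_top]
  obtain ⟨F, hF, hfd, hmin⟩ := exists_sup_adjoin_eq_top_minimal (k := k) α
  refine ⟨F, ?_, hfd⟩
  rintro ⟨N, hN⟩
  let M : IntermediateField k E := (N.map F.toSubfield.subtype).toIntermediateField (hk _)
  have hmemM (y : F) : (y : E) ∈ M ↔ y ∈ N := by
    constructor
    · rintro ⟨z, hz, hzy⟩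
      exact Subtype.ext hzy ▸ hz
    · exact fun hy ↦ ⟨y, hy, rfl⟩
  obtain ⟨x, hx⟩ : ∃ x, x ∉ N := by
    by_contra! h
    exact hN.1 ((Subring.eq_top_iff' N).mpr h)
  have hMF : M < F := by
    refine SetLike.lt_iff_le_and_exists.mpr ⟨?_, (x : E), x.2, fun h ↦ hx ((hmemM x).mp h)⟩
    rintro _ ⟨z, -, rfl⟩
    exact z.2
  have hM := hmin M hMF
  -- `E` is generated by `x` over `M(α)`, because `F` is generated by `x` over `M`.
  obtain ⟨V, hV, hVmax⟩ := exists_isCoatom_of_forall_eq_top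
    (S := (M ⊔ IntermediateField.adjoin k {α}).toSubfield.toSubring) (Set.finite_singleton (x : E))
    (fun h ↦ hM (eq_top_iff.mpr fun y _ ↦ (Subring.eq_top_iff' _).mp h y))
    (fun W hW hxW ↦ by
      let W' := W.toIntermediateField (hk W)
      have hMW : M ⊔ IntermediateField.adjoin k {α} ≤ W' := hW
      have hFW : F ≤ W' := by
        have : W.comap F.toSubfield.subtype = ⊤ :=
          hN.2 _ (SetLike.lt_iff_le_and_exists.mpr
            ⟨fun y hy ↦ hMW (le_sup_left (a := M) ((hmemM y).mpr hy)), x, hxW rfl, hx⟩)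
        exact fun y hy ↦ (Subring.eq_top_iff' _).mp this ⟨y, hy⟩
      have : W' = ⊤ := top_unique (hF ▸ sup_le hFW (le_sup_right.trans hMW))
      exact (Subring.eq_top_iff' W).mpr fun y ↦
        show y ∈ W' from this ▸ IntermediateField.mem_top)
  refine ha V hVmax (hV ?_)
  refine le_sup_right (a := M) (b := IntermediateField.adjoin k {α}) ?_
  rw [← hα]
  exact IntermediateField.subset_adjoin _ _ ⟨V, hVmax, rfl⟩

end FiniteIndex

/-! ### The characterization -/

theorem theorem2p2 (E : Type*) [Field E] :
    (IsAbsolutelyAlgebraic E →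
      IsGreatest (nonsubmaximalSubfields E) (largestNonsubmaximalSubfield E)) ∧
    List.TFAE [
      (RgMax E).Finite,
      IsAbsolutelyAlgebraic E ∧ FiniteDimensional (largestNonsubmaximalSubfield E) E,
      ∃ F : Subfield E, ¬ IsSubmaximal F ∧ FiniteDimensional F E] ∧
    ∀ F : Subfield E, ¬ IsSubmaximal F → FiniteDimensional F E →
      F = largestNonsubmaximalSubfield E := by
  refine ⟨isGreatest_largestNonsubmaximalSubfield, ?_,
    fun F hF _ ↦ eq_largestNonsubmaximalSubfield hF⟩
  tfae_have 1 → 3 := by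
    intro hfin
    have hE : IsAbsolutelyAlgebraic E := by
      by_contra h
      exact infinite_RgMax_of_not_isAbsolutelyAlgebraic h hfin
    obtain ⟨p, _, _, _⟩ := hE
    obtain ⟨F, hF, hfd⟩ := exists_not_isSubmaximal_finiteDimensional
      (algebraMap_zmod_mem (p := p) (E := E)) hfin
    exact ⟨F.toSubfield, hF, hfd⟩
  tfae_have 3 → 1 := by
    rintro ⟨F, hF, _⟩
    exact finite_RgMax_of_finiteDimensional hF
  tfae_have 3 → 2 := by
    rintro ⟨F, hF, hfd⟩
    exact ⟨(isAbsolutelyAlgebraic_of_not_isSubmaximal hF).of_isAlgebraic,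
      eq_largestNonsubmaximalSubfield hF ▸ hfd⟩
  tfae_have 2 → 3 := by
    rintro ⟨hE, hfd⟩
    exact ⟨_, (isGreatest_largestNonsubmaximalSubfield hE).1, hfd⟩
  tfae_finish
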